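/- Let $k$ be a field, $A=k[x_1,\dots,x_n]$ the standard graded polynomial ring, $\mathfrak m=(x_1,\dots,x_n)$, and let $I\subset A$ be a graded $\mathfrak m$-primary ideal. For an integer $\mu$ let $(I_{\le\mu})$ (resp. $(I_{<\mu})$) be the ideal generated by the forms in $I$ of degree at most (resp. less than) $\mu$, and set $d:=\min\{\mu \mid \exists p\ge 0,\ (I_{\le\mu})I^p=I^{p+1}\}$. Let $g_1,\dots,g_m\in I$ be forms of degree $d$ and $J:=(g_1,\dots,g_m)$, such that $J+(I_{<d})$ is a reduction of $I$ (i.e. it is contained in $I$ and $(J+(I_{<d}))I^p=I^{p+1}$ for some $p\ge 0$). Let $S:=A[T_1,\dots,T_m]$ be bigraded by $\operatorname{bideg}(x_i)=(1,0)$, $\operatorname{bideg}(T_j)=(0,1)$, and $\mathfrak n:=(T_1,\dots,T_m)$. Let $\mathcal R_I:=\bigoplus_{t\ge 0}I^t(td)$ be the Rees algebra $\bigoplus_{t\ge0}I^tX^t\subset A[X]$, bigraded by $(\mathcal R_I)_{\mu,t}=(I^t)_{\mu+td}X^t$ and viewed as a bigraded $S$-module through the $A$-algebra map $S\to\mathcal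 R_I$, $T_j\mapsto g_jX$. Write $H^i_{\mathfrak m}$, $H^i_{\mathfrak n}$, $H^i_{\mathfrak m+\mathfrak n}$ for local cohomology, computed and bigraded by the Čech complexes $\mathcal C_{\mathfrak m}$, $\mathcal C_{\mathfrak n}$, $\mathcal C_{\mathfrak m+\mathfrak n}$ on $(x_i)_i$, $(T_j)_j$ and $(x_1,\dots,x_n,T_1,\dots,T_m)$, and put $N:=H^1_{\mathfrak m}(\mathcal R_I)$. Then there are isomorphisms of bigraded $S$-modules $$H^0_{\mathfrak n}(N)\ \xleftarrow[\ \varphi\ ]{\simeq}\ H^1_{\mathfrak m+\mathfrak n}(\mathcal R_I)\ \xrightarrow[\ \psi\ ]{\simeq}\ H^0_{\mathfrak m}(H^1_{\mathfrak n}(\mathcal R_I)).$$ They are natural: they are the edge homomorphisms of the two spectral sequences of the double Čech complex $\mathcal C_{\mathfrak n}\mathcal C_{\mathfrak m}\mathcal R_I$, whose total complex is $\mathcal C_{\mathfrak m+\mathfrak n}\mathcal R_I$. That is, $\varphi$ followed by the inclusion $H^0_{\mathfrak n}(N)\subseteq N=H^1_{\mathfrak m}(\mathcal R_I)$ is the canonical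 map $H^1_{\mathfrak m+\mathfrak n}(\mathcal R_I)\to H^1_{\mathfrak m}(\mathcal R_I)$ induced by the projection $\mathcal C_{\mathfrak m+\mathfrak n}\to\mathcal C_{\mathfrak m}$, and $\psi$ followed by the inclusion $H^0_{\mathfrak m}(H^1_{\mathfrak n}(\mathcal R_I))\subseteq H^1_{\mathfrak n}(\mathcal R_I)$ is the canonical map $H^1_{\mathfrak m+\mathfrak n}(\mathcal R_I)\to H^1_{\mathfrak n}(\mathcal R_I)$ induced by the projection $\mathcal C_{\mathfrak m+\mathfrak n}\to\mathcal C_{\mathfrak n}$. -/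

import Mathlib

open Polynomial

noncomputable section

/-! ### The Čech complex of a module on a family of ring elements -/

section Cech

variable {R : Type*} [CommRing R]

theorem isUnit_algebraMap_localizedPowers {a b : R} (h : a ∣ b)
    (M : Type*) [AddCommGroup M] [Module R M] (x : Submonoid.powers a) :
    IsUnit (algebraMap R (Module.End R (LocalizedModule (Submonoid.powers b) M)) x) := by
  obtain ⟨c, rfl⟩ := h
  obtain ⟨_, n, rfl⟩ := x
  have hu := IsLocalizedModule.map_units
    (LocalizedModule.mkLinearMap (Submonoid.powers (a * c)) M)
    ⟨a * c, Submonoid.mem_powers (a * c)⟩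
  rw [map_mul] at hu
  have hcomm : Commute
      (algebraMap R (Module.End R (LocalizedModule (Submonoid.powers (a * c)) M)) a)
      (algebraMap R (Module.End R (LocalizedModule (Submonoid.powers (a * c)) M)) c) :=
    Algebra.commutes a _
  simpa using (hcomm.isUnit_mul_iff.1 hu).1.pow n

/-- The canonical map `M_a → M_b`, for `a` dividing `b`. -/
def localizedPowersMap {a b : R} (h : a ∣ b) (M : Type*) [AddCommGroup M] [Module R M] :
    LocalizedModule (Submonoid.powers a) M →ₗ[R] LocalizedModule (Submonoid.powers b) M :=
  LocalizedModule.lift (Submonoid.powers a)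
    (LocalizedModule.mkLinearMap (Submonoid.powers b) M)
    (isUnit_algebraMap_localizedPowers h M)

variable {ι : Type*} [LinearOrder ι] (v : ι → R)

/-- The Čech cochains `C^p(v_i, i ∈ u; M) = ∏_{s ⊆ u, |s| = p} M_{v_s}`, where
`v_s = ∏_{i ∈ s} v_i`. -/
abbrev CechCochain (u : Finset ι) (p : ℕ) (M : Type*) [AddCommGroup M] [Module R M] : Type _ :=
  (s : {s : Finset ι // s ⊆ u ∧ s.card = p}) →
    LocalizedModule (Submonoid.powers (∏ i ∈ s.1, v i)) M

/-- The Čech differential `(d c)_s = ∑_{i ∈ s} (-1)^{|{j ∈ s, j < i}|} c_{s ∖ i}`. -/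
def cechD (u : Finset ι) (p : ℕ) (M : Type*) [AddCommGroup M] [Module R M] :
    CechCochain v u p M →ₗ[R] CechCochain v u (p + 1) M :=
  LinearMap.pi fun s => ∑ i : {i // i ∈ s.1},
    (-1 : R) ^ (s.1.filter (· < i.1)).card •
      (localizedPowersMap
          (Finset.prod_dvd_prod_of_subset _ _ v (Finset.erase_subset i.1 s.1)) M).comp
        (LinearMap.proj (⟨s.1.erase i.1, (Finset.erase_subset _ _).trans s.2.1, by
          rw [Finset.card_erase_of_mem i.2, s.2.2, Nat.add_sub_cancel]⟩ :
            {s : Finset ι // s ⊆ u ∧ s.card = p}))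

/-- The Čech coboundaries of degree `p`. -/
def cechB (u : Finset ι) (M : Type*) [AddCommGroup M] [Module R M] :
    (p : ℕ) → Submodule R (CechCochain v u p M)
  | 0 => ⊥
  | p + 1 => LinearMap.range (cechD v u p M)

/-- The local cohomology module `H^p_𝔞(M)`, `𝔞` the ideal generated by the `v_i` with `i ∈ u`,
as the cohomology of the Čech complex: cocycles modulo coboundaries. -/
def CechH (u : Finset ι) (p : ℕ) (M : Type*) [AddCommGroup M] [Module R M] : Type _ :=
  LinearMap.ker (cechD v u p M) ⧸
    (cechB v u M p).comap (LinearMap.ker (cechD v u p M)).subtype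

instance (u : Finset ι) (p : ℕ) (M : Type*) [AddCommGroup M] [Module R M] :
    AddCommGroup (CechH v u p M) :=
  inferInstanceAs (AddCommGroup (LinearMap.ker (cechD v u p M) ⧸
    (cechB v u M p).comap (LinearMap.ker (cechD v u p M)).subtype))

instance (u : Finset ι) (p : ℕ) (M : Type*) [AddCommGroup M] [Module R M] :
    Module R (CechH v u p M) :=
  inferInstanceAs (Module R (LinearMap.ker (cechD v u p M) ⧸
    (cechB v u M p).comap (LinearMap.ker (cechD v u p M)).subtype))

/-- The class of a cocycle. -/
def CechH.mk (u : Finset ι) (p : ℕ) (M : Type*) [AddCommGroup M] [Module R M] :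
    LinearMap.ker (cechD v u p M) →ₗ[R] CechH v u p M :=
  Submodule.mkQ ((cechB v u M p).comap (LinearMap.ker (cechD v u p M)).subtype)

/-- The canonical map `H^0_𝔞(M) → M` (the inclusion of the `𝔞`-power torsion), which sends the
class of a `0`-cochain to its only component, that lies in `M_1 = M`. -/
def cechHZeroToModule (u : Finset ι) (M : Type*) [AddCommGroup M] [Module R M] :
    CechH v u 0 M →ₗ[R] M :=
  Submodule.liftQ ((cechB v u M 0).comap (LinearMap.ker (cechD v u 0 M)).subtype)
    ((LocalizedModule.lift (Submonoid.powers (∏ i ∈ (∅ : Finset ι), v i)) LinearMap.id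
        (fun x => by
          obtain ⟨_, n, rfl⟩ := x
          simp)).comp
      ((LinearMap.proj (⟨∅, Finset.empty_subset u, Finset.card_empty⟩ :
          {s : Finset ι // s ⊆ u ∧ s.card = 0})).comp
        (LinearMap.ker (cechD v u 0 M)).subtype))
    (by
      intro c hc
      have h0 : c.1 = 0 := hc
      have h1 : c = 0 := Subtype.ext h0
      rw [h1]
      exact Submodule.zero_mem _)

/-- Restriction of cochains from the Čech complex on `u'` to the one on `u ⊆ u'`. -/
def cechRestrictCochain {u u' : Finset ι} (h : u ⊆ u') (p : ℕ)
    (M : Type*) [AddCommGroup M] [Module R M] :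
    CechCochain v u' p M →ₗ[R] CechCochain v u p M :=
  LinearMap.pi fun s => LinearMap.proj
    (⟨s.1, s.2.1.trans h, s.2.2⟩ : {s : Finset ι // s ⊆ u' ∧ s.card = p})

theorem cechD_cechRestrictCochain {u u' : Finset ι} (h : u ⊆ u') (p : ℕ)
    (M : Type*) [AddCommGroup M] [Module R M] (c : CechCochain v u' p M) :
    cechD v u p M (cechRestrictCochain v h p M c) =
      cechRestrictCochain v h (p + 1) M (cechD v u' p M c) := by
  funext s
  simp [cechD, cechRestrictCochain]

/-- The canonical map `H^p_𝔟(M) → H^p_𝔞(M)`, for `𝔞 ⊆ 𝔟` generated by the families of the `v_i`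
with `i ∈ u ⊆ u'`, induced by the projection of the Čech complex on `u'` onto the one on `u`. -/
def cechRestrict {u u' : Finset ι} (h : u ⊆ u') (p : ℕ)
    (M : Type*) [AddCommGroup M] [Module R M] :
    CechH v u' p M →ₗ[R] CechH v u p M :=
  Submodule.mapQ ((cechB v u' M p).comap (LinearMap.ker (cechD v u' p M)).subtype)
    ((cechB v u M p).comap (LinearMap.ker (cechD v u p M)).subtype)
    ((cechRestrictCochain v h p M).restrict (fun c hc => by
      rw [LinearMap.mem_ker] at hc ⊢
      rw [cechD_cechRestrictCochain, hc, map_zero]))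
    (by
      rintro ⟨c, hc⟩ hb
      change cechRestrictCochain v h p M c ∈ cechB v u M p
      change c ∈ cechB v u' M p at hb
      cases p with
      | zero =>
        have h0 : c = 0 := hb
        rw [h0, map_zero]
        exact Submodule.zero_mem _
      | succ p =>
        obtain ⟨e, rfl⟩ := hb
        exact ⟨cechRestrictCochain v h p M e, cechD_cechRestrictCochain v h p M e⟩)

/-! ### Gradings

A grading of `M` by `G` is given by its homogeneous components `𝓜 δ`, and `v i` is homogeneous of
degree `deg i`. -/

variable {G : Type*} [AddCommGroup G] (deg : ι → G)

/-- The component of degree `δ` of `M_{v_s}`: it consists of the fractions `m / v_s ^ e` with `m`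
homogeneous of degree `δ + e • deg v_s`. -/
def localizedComponent (s : Finset ι) {M : Type*} [AddCommGroup M] [Module R M]
    (𝓜 : G → AddSubgroup M) (δ : G) :
    AddSubgroup (LocalizedModule (Submonoid.powers (∏ i ∈ s, v i)) M) :=
  AddSubgroup.closure {z | ∃ (e : ℕ) (m : M), m ∈ 𝓜 (δ + e • ∑ i ∈ s, deg i) ∧
    z = LocalizedModule.mk m ⟨(∏ i ∈ s, v i) ^ e, Submonoid.mem_powers_iff _ _ |>.2 ⟨e, rfl⟩⟩}

/-- The component of degree `δ` of the Čech cochains. -/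
def cechCochainComponent (u : Finset ι) (p : ℕ) {M : Type*} [AddCommGroup M] [Module R M]
    (𝓜 : G → AddSubgroup M) (δ : G) : AddSubgroup (CechCochain v u p M) :=
  AddSubgroup.pi Set.univ fun s => localizedComponent v deg s.1 𝓜 δ

/-- The component of degree `δ` of `H^p_𝔞(M)`: the classes of the homogeneous cocycles of
degree `δ`. -/
def cechHComponent (u : Finset ι) (p : ℕ) {M : Type*} [AddCommGroup M] [Module R M]
    (𝓜 : G → AddSubgroup M) (δ : G) : AddSubgroup (CechH v u p M) :=
  ((cechCochainComponent v deg u p 𝓜 δ).comap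
      (LinearMap.ker (cechD v u p M)).subtype.toAddMonoidHom).map
    (CechH.mk v u p M).toAddMonoidHom

end Cech

/-! ### Ideals of the polynomial ring `A = k[x_1, …, x_n]` and the Rees module -/

section Rees

variable {k : Type*} [Field k] {n m : ℕ}

/-- The maximal ideal `𝔪 = (x_1, …, x_n)`. -/
def irrelevantIdeal (k : Type*) [Field k] (n : ℕ) : Ideal (MvPolynomial (Fin n) k) :=
  Ideal.span (Set.range MvPolynomial.X)

/-- `(I_{≤ μ})`, the ideal generated by the forms in `I` of degree at most `μ`. -/
def idealLE (I : Ideal (MvPolynomial (Fin n) k)) (μ : ℕ) : Ideal (MvPolynomial (Fin n) k) :=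
  Ideal.span {a | a ∈ I ∧ ∃ ν ≤ μ, a.IsHomogeneous ν}

/-- `(I_{< μ})`, the ideal generated by the forms in `I` of degree less than `μ`. -/
def idealLT (I : Ideal (MvPolynomial (Fin n) k)) (μ : ℕ) : Ideal (MvPolynomial (Fin n) k) :=
  Ideal.span {a | a ∈ I ∧ ∃ ν < μ, a.IsHomogeneous ν}

/-- `K` is a reduction of `I`. -/
def IsReductionOf {A : Type*} [CommRing A] (K I : Ideal A) : Prop :=
  K ≤ I ∧ ∃ p : ℕ, K * I ^ p = I ^ (p + 1)

/-- The Rees algebra `⊕_{t ≥ 0} I^t X^t ⊆ A[X]`, viewed as a module over `S = A[T_1, …, T_m]`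
through the `A`-algebra map `S → ⊕ I^t X^t`, `T_j ↦ g_j X`, where `g_1, …, g_m` lie in `I`. -/
def ReesModule (I : Ideal (MvPolynomial (Fin n) k)) (g : Fin m → MvPolynomial (Fin n) k)
    (_hg : ∀ j, g j ∈ I) : Type _ :=
  reesAlgebra I

instance (I : Ideal (MvPolynomial (Fin n) k)) (g : Fin m → MvPolynomial (Fin n) k)
    (hg : ∀ j, g j ∈ I) : AddCommGroup (ReesModule I g hg) :=
  inferInstanceAs (AddCommGroup (reesAlgebra I))

/-- The `A`-algebra map `A[T_1, …, T_m] → ⊕ I^t X^t`, `T_j ↦ g_j X`. -/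
def reesMap (I : Ideal (MvPolynomial (Fin n) k)) (g : Fin m → MvPolynomial (Fin n) k)
    (hg : ∀ j, g j ∈ I) :
    MvPolynomial (Fin m) (MvPolynomial (Fin n) k) →ₐ[MvPolynomial (Fin n) k] reesAlgebra I :=
  MvPolynomial.aeval fun j =>
    ⟨Polynomial.monomial 1 (g j), reesAlgebra.monomial_mem.2 (by simpa using hg j)⟩

instance (I : Ideal (MvPolynomial (Fin n) k)) (g : Fin m → MvPolynomial (Fin n) k)
    (hg : ∀ j, g j ∈ I) :
    Module (MvPolynomial (Fin m) (MvPolynomial (Fin n) k)) (ReesModule I g hg) :=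
  Module.compHom (reesAlgebra I) (reesMap I g hg).toRingHom

/-- The element of `A[X]` underlying an element of the Rees module. -/
def ReesModule.toPoly {I : Ideal (MvPolynomial (Fin n) k)} {g : Fin m → MvPolynomial (Fin n) k}
    {hg : ∀ j, g j ∈ I} : ReesModule I g hg →+ (MvPolynomial (Fin n) k)[X] :=
  (reesAlgebra I).val.toRingHom.toAddMonoidHom

/-- The bigrading of `𝓡_I = ⊕_{t ≥ 0} I^t(td)`: the component of bidegree `(μ, t)` consists of the
elements `a X^t` with `a ∈ I^t` homogeneous of degree `μ + td`. -/
def ReesModule.component (I : Ideal (MvPolynomial (Fin n) k))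
    (g : Fin m → MvPolynomial (Fin n) k) (hg : ∀ j, g j ∈ I) (d : ℕ) (δ : ℤ × ℤ) :
    AddSubgroup (ReesModule I g hg) where
  carrier := {f | ∀ (t : ℕ) (w : Fin n →₀ ℕ), (f.toPoly.coeff t).coeff w ≠ 0 →
    (t : ℤ) = δ.2 ∧ (w.degree : ℤ) = δ.1 + t * d}
  zero_mem' := fun t w h => absurd (by simp) h
  add_mem' := by
    intro a b ha hb t w h
    by_cases h1 : (a.toPoly.coeff t).coeff w = 0
    · refine hb t w fun h2 => h ?_
      rw [map_add, Polynomial.coeff_add, MvPolynomial.coeff_add, h1, h2, add_zero]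
    · exact ha t w h1
  neg_mem' := by
    intro a ha t w h
    refine ha t w fun h1 => h ?_
    rw [map_neg, Polynomial.coeff_neg, MvPolynomial.coeff_neg, h1, neg_zero]

/-- The variables `x_1, …, x_n, T_1, …, T_m` of `S = A[T_1, …, T_m]`, in this order. -/
def biVar (k : Type*) [Field k] (n m : ℕ) :
    Fin n ⊕ₗ Fin m → MvPolynomial (Fin m) (MvPolynomial (Fin n) k) :=
  fun i => Sum.elim (fun a => MvPolynomial.C (MvPolynomial.X a)) (fun b => MvPolynomial.X b)
    (ofLex i)

/-- The bidegrees of the variables: `bideg x_i = (1, 0)` and `bideg T_j = (0, 1)`. -/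
def biDeg (n m : ℕ) : Fin n ⊕ₗ Fin m → ℤ × ℤ :=
  fun i => Sum.elim (fun _ => (1, 0)) (fun _ => (0, 1)) (ofLex i)

/-- The indices of `x_1, …, x_n`, generators of `𝔪`. -/
def xVars (n m : ℕ) : Finset (Fin n ⊕ₗ Fin m) :=
  Finset.univ.filter fun i => (ofLex i).isLeft = true

/-- The indices of `T_1, …, T_m`, generators of `𝔫`. -/
def tVars (n m : ℕ) : Finset (Fin n ⊕ₗ Fin m) :=
  Finset.univ.filter fun i => (ofLex i).isRight = true

end Rees

end

attribute [local instance] MvPolynomial.gradedAlgebra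

/-! The Rees algebra is a subring of the domain `A[X]`, on which `x_i` acts as multiplication by
`x_i` and `T_j` as multiplication by `g_j X`. If `n > 0`, then `x_1` is a nonzerodivisor on it, and
so is some `T_j`: if every `g_j` vanished, `(I_{<d})` alone would be a reduction of `I`, against the
minimality of `d` (`exists_ne_zero_of_isReductionOf`). So `H^0_𝔪` and `H^0_𝔫` of the Rees algebra
vanish, one row of each spectral sequence is zero, and the edge maps out of `H^1_{𝔪+𝔫}` are
isomorphisms.

The spectral sequences are replaced by explicit cocycles. For any module `M` and any `𝔞` with a
generator `v_a` regular on `M`, the restriction `H^1_{𝔞+𝔟}(M) → H^1_𝔞(M)` is injective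
(`cechRestrict_one_injective`), its image is `𝔟`-power torsion
(`exists_pow_smul_cechRestrict_one_eq_zero`), and every torsion class lifts
(`exists_cechRestrict_one_eq`). Since `H^0_𝔟` is exactly that torsion, `cechEdgeEquiv` follows; it
is used twice, with the roles of `𝔪` and `𝔫` exchanged.

Degrees are preserved and reflected (`cechRestrict_one_mem_iff`) because division by `v_a` respects
homogeneity: a cofactor of a nonzero form in a form is a form. If `n = 0`, then `I = 0` and all the
modules vanish. -/

noncomputable section

set_option linter.unusedSectionVars false

/-! ### Fractions with denominators powers of one element. -/

section LocalizedPowers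

variable {R : Type*} [CommRing R] {M : Type*} [AddCommGroup M] [Module R M]

/-- The canonical map `M → M_a`. -/
abbrev toLocalizedPowers (a : R) (M : Type*) [AddCommGroup M] [Module R M] :
    M →ₗ[R] LocalizedModule (Submonoid.powers a) M :=
  LocalizedModule.mkLinearMap (Submonoid.powers a) M

theorem exists_pow_smul_eq_toLocalizedPowers {a : R}
    (x : LocalizedModule (Submonoid.powers a) M) :
    ∃ (e : ℕ) (m : M), a ^ e • x = toLocalizedPowers a M m := by
  obtain ⟨⟨m, ⟨_, e, rfl⟩⟩, h⟩ :=
    IsLocalizedModule.surj (Submonoid.powers a) (toLocalizedPowers a M) x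
  exact ⟨e, m, h⟩

theorem exists_pow_smul_eq (a : R) (m : M) (e : ℕ) :
    ∃ x : LocalizedModule (Submonoid.powers a) M, a ^ e • x = toLocalizedPowers a M m :=
  ⟨LocalizedModule.mk m ⟨a ^ e, e, rfl⟩, by
    rw [LocalizedModule.smul'_mk]
    exact LocalizedModule.mk_cancel (⟨a ^ e, e, rfl⟩ : Submonoid.powers a) m⟩

/-- A divisor of `b` is invertible on `M_b`. This is the tool for clearing denominators throughout.
-/
theorem pow_smul_localizedPowers_injective {a b : R} (h : a ∣ b) (e : ℕ)
    {x y : LocalizedModule (Submonoid.powers b) M} (hxy : a ^ e • x = a ^ e • y) : x = y := by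
  have hu := isUnit_algebraMap_localizedPowers h M ⟨a ^ e, e, rfl⟩
  exact ((Module.End.isUnit_iff _).1 hu).1 hxy

theorem toLocalizedPowers_eq_zero_iff {a : R} {m : M} :
    toLocalizedPowers a M m = 0 ↔ ∃ e : ℕ, a ^ e • m = 0 := by
  rw [IsLocalizedModule.eq_zero_iff (Submonoid.powers a)]
  constructor
  · rintro ⟨⟨_, e, rfl⟩, h⟩
    exact ⟨e, h⟩
  · rintro ⟨e, h⟩
    exact ⟨⟨a ^ e, e, rfl⟩, h⟩

@[simp]
theorem localizedPowersMap_toLocalizedPowers {a b : R} (h : a ∣ b) (m : M) :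
    localizedPowersMap h M (toLocalizedPowers a M m) = toLocalizedPowers b M m :=
  LocalizedModule.lift_mk_one _ _ _ m

theorem pow_smul_eq_zero_of_regular {a : R} (ha : ∀ m : M, a • m = 0 → m = 0) (e : ℕ) {m : M}
    (h : a ^ e • m = 0) : m = 0 := by
  induction e with
  | zero => simpa using h
  | succ e ih => exact ih (ha _ (by rwa [smul_smul, ← pow_succ']))

theorem toLocalizedPowers_injective {a : R} (ha : ∀ m : M, a • m = 0 → m = 0) :
    Function.Injective (toLocalizedPowers a M) := by
  rw [injective_iff_map_eq_zero]
  intro m hm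
  obtain ⟨e, he⟩ := toLocalizedPowers_eq_zero_iff.1 hm
  exact pow_smul_eq_zero_of_regular ha e he

/-- `M_b → M_{ab}` is injective if `a` is a nonzerodivisor on `M`. -/
theorem localizedPowersMap_injective {a b c : R} (hc : c = a * b)
    (ha : ∀ m : M, a • m = 0 → m = 0) (h : b ∣ c) :
    Function.Injective (localizedPowersMap h M) := by
  rw [injective_iff_map_eq_zero]
  intro x hx
  obtain ⟨e, m, hm⟩ := exists_pow_smul_eq_toLocalizedPowers x
  have h1 := congrArg (localizedPowersMap h M) hm
  rw [map_smul, hx, smul_zero, localizedPowersMap_toLocalizedPowers] at h1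
  obtain ⟨f, hf⟩ := toLocalizedPowers_eq_zero_iff.1 h1.symm
  rw [hc, mul_pow, mul_smul] at hf
  have h2 := pow_smul_eq_zero_of_regular ha f hf
  refine pow_smul_localizedPowers_injective dvd_rfl e ?_
  rw [hm, smul_zero]
  exact toLocalizedPowers_eq_zero_iff.2 ⟨f, h2⟩

/-- Cross-multiplication for `x = m / a ^ e` and `y = m' / b ^ f`, compared in a common
localization. -/
theorem localizedPowersMap_eq_iff {a b c : R} (hac : a ∣ c) (hbc : b ∣ c) {e f : ℕ}
    {x : LocalizedModule (Submonoid.powers a) M} {y : LocalizedModule (Submonoid.powers b) M}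
    {m m' : M} (hx : a ^ e • x = toLocalizedPowers a M m)
    (hy : b ^ f • y = toLocalizedPowers b M m') :
    localizedPowersMap hac M x = localizedPowersMap hbc M y ↔
      toLocalizedPowers c M (b ^ f • m) = toLocalizedPowers c M (a ^ e • m') := by
  have h1 := congrArg (localizedPowersMap hac M) hx
  have h2 := congrArg (localizedPowersMap hbc M) hy
  rw [map_smul, localizedPowersMap_toLocalizedPowers] at h1 h2
  rw [map_smul, map_smul, ← h1, ← h2]
  constructor
  · intro h
    rw [h, smul_comm]
  · intro h
    rw [smul_comm] at h
    exact pow_smul_localizedPowers_injective hbc f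
      (pow_smul_localizedPowers_injective hac e h)

theorem subsingleton_localizedPowers {a : R} (h : ∀ m : M, a • m = 0) :
    Subsingleton (LocalizedModule (Submonoid.powers a) M) := by
  refine subsingleton_of_forall_eq 0 fun x => ?_
  obtain ⟨e, m, hm⟩ := exists_pow_smul_eq_toLocalizedPowers x
  refine pow_smul_localizedPowers_injective dvd_rfl e ?_
  rw [hm, smul_zero]
  exact toLocalizedPowers_eq_zero_iff.2 ⟨1, by rw [pow_one, h]⟩

end LocalizedPowers

/-! ### The Čech differential in degrees 0 and 1. -/

section LowDegree

variable {R : Type*} [CommRing R] {ι : Type*} [LinearOrder ι] (v : ι → R)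
  {M : Type*} [AddCommGroup M] [Module R M] {u : Finset ι}

/-- The only index of a component of a Čech `0`-cochain. -/
abbrev emptyIndex (u : Finset ι) : {s : Finset ι // s ⊆ u ∧ s.card = 0} :=
  ⟨∅, Finset.empty_subset u, Finset.card_empty⟩

/-- The index of the component at `i` of a Čech `1`-cochain. -/
abbrev singletonIndex {i : ι} (hi : i ∈ u) : {s : Finset ι // s ⊆ u ∧ s.card = 1} :=
  ⟨{i}, Finset.singleton_subset_iff.2 hi, Finset.card_singleton i⟩

/-- The index of the component at `i, j` of a Čech `2`-cochain. -/
abbrev pairIndex {i j : ι} (hi : i ∈ u) (hj : j ∈ u) (hij : i ≠ j) :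
    {s : Finset ι // s ⊆ u ∧ s.card = 1 + 1} :=
  ⟨{i, j}, by simp [Finset.insert_subset_iff, hi, hj], Finset.card_pair hij⟩

/-- The index `s.erase i` often equals the expected one only propositionally. Allowing any `s'`
equal to it confines the transport between dependent types to this proof. -/
theorem cechD_apply {p : ℕ} (c : CechCochain v u p M)
    (s : {s : Finset ι // s ⊆ u ∧ s.card = p + 1})
    (f : {i // i ∈ s.1} → LocalizedModule (Submonoid.powers (∏ i ∈ s.1, v i)) M)
    (hf : ∀ i, ∃ (s' : {s : Finset ι // s ⊆ u ∧ s.card = p}) (hs' : s'.1 = s.1.erase i.1),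
      f i = (-1 : R) ^ (s.1.filter (· < i.1)).card •
        localizedPowersMap (Finset.prod_dvd_prod_of_subset s'.1 s.1 v
          (hs'.trans_subset (Finset.erase_subset _ _))) M (c s')) :
    cechD v u p M c s = ∑ i, f i := by
  simp only [cechD, LinearMap.pi_apply, LinearMap.sum_apply]
  refine Finset.sum_congr rfl fun i _ => ?_
  obtain ⟨⟨s', h⟩, hs', hi⟩ := hf i
  simp only at hs'
  subst hs'
  rw [hi]
  rfl

theorem cechD_zero_apply (c : CechCochain v u 0 M) {i : ι} (hi : i ∈ u) :
    cechD v u 0 M c (singletonIndex hi) =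
      localizedPowersMap (Finset.prod_dvd_prod_of_subset _ _ v (Finset.empty_subset {i})) M
        (c (emptyIndex u)) := by
  rw [cechD_apply v c (singletonIndex hi) (fun _ =>
    localizedPowersMap (Finset.prod_dvd_prod_of_subset _ _ v (Finset.empty_subset {i})) M
        (c (emptyIndex u)))]
  · simp
  · rintro ⟨l, hl⟩
    obtain rfl := Finset.mem_singleton.1 hl
    refine ⟨emptyIndex u, by simp, ?_⟩
    have h0 : (({l} : Finset ι).filter (· < l)).card = 0 := by
      simp [Finset.filter_singleton]
    dsimp only
    rw [h0, pow_zero, one_smul]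

theorem cechD_one_apply (c : CechCochain v u 1 M) {i j : ι} (hi : i ∈ u) (hj : j ∈ u)
    (hij : i < j) :
    cechD v u 1 M c (pairIndex hi hj hij.ne) =
      localizedPowersMap (Finset.prod_dvd_prod_of_subset {j} {i, j} v (by simp)) M
        (c (singletonIndex hj)) -
      localizedPowersMap (Finset.prod_dvd_prod_of_subset {i} {i, j} v (by simp)) M
        (c (singletonIndex hi)) := by
  rw [cechD_apply v c (pairIndex hi hj hij.ne) (fun l => if l.1 = i then
      localizedPowersMap (Finset.prod_dvd_prod_of_subset {j} {i, j} v (by simp)) M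
        (c (singletonIndex hj)) else
      - localizedPowersMap (Finset.prod_dvd_prod_of_subset {i} {i, j} v (by simp)) M
        (c (singletonIndex hi)))]
  · rw [Fintype.sum_eq_add (⟨i, by simp⟩ : {l // l ∈ ({i, j} : Finset ι)}) ⟨j, by simp⟩
      (by simpa using hij.ne), if_pos rfl, if_neg hij.ne', sub_eq_add_neg]
    rintro ⟨l, hl⟩ ⟨h1, h2⟩
    simp only [Finset.mem_insert, Finset.mem_singleton] at hl
    rcases hl with hl | hl
    · exact (h1 (Subtype.ext hl)).elim
    · exact (h2 (Subtype.ext hl)).elim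
  · rintro ⟨l, hl⟩
    have hl' := hl
    simp only [Finset.mem_insert, Finset.mem_singleton] at hl'
    dsimp only
    rcases hl' with rfl | rfl
    · have h0 : (({l, j} : Finset ι).filter (· < l)).card = 0 := by
        simp [Finset.filter_insert, Finset.filter_singleton, hij.le]
      refine ⟨singletonIndex hj, (Finset.erase_insert (by simpa using hij.ne)).symm, ?_⟩
      rw [h0, pow_zero, one_smul, if_pos rfl]
    · have h1 : (({i, l} : Finset ι).filter (· < l)).card = 1 := by
        simp [Finset.filter_insert, Finset.filter_singleton, hij]
      refine ⟨singletonIndex hi, ?_, ?_⟩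
      · rw [Finset.pair_comm, Finset.erase_insert (by simpa using hij.ne')]
      · rw [h1, pow_one, neg_one_smul, if_neg hij.ne']

theorem mem_ker_cechD_zero_iff (c : CechCochain v u 0 M) :
    c ∈ LinearMap.ker (cechD v u 0 M) ↔ ∀ i ∈ u,
      localizedPowersMap (Finset.prod_dvd_prod_of_subset _ _ v (Finset.empty_subset {i})) M
        (c (emptyIndex u)) = 0 := by
  rw [LinearMap.mem_ker]
  constructor
  · intro h i hi
    rw [← cechD_zero_apply v c hi, h, Pi.zero_apply]
  · intro h
    funext ⟨s, hs, hc⟩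
    obtain ⟨i, rfl⟩ := Finset.card_eq_one.1 hc
    have hi := Finset.singleton_subset_iff.1 hs
    exact (cechD_zero_apply v c hi).trans (h i hi)

/-- A `1`-cochain is a cocycle if its components at `i` and `j` agree in `M_{v_i v_j}`. -/
theorem mem_ker_cechD_one_iff (c : CechCochain v u 1 M) :
    c ∈ LinearMap.ker (cechD v u 1 M) ↔ ∀ (i j : ι) (hi : i ∈ u) (hj : j ∈ u), i ≠ j →
      localizedPowersMap (Dvd.intro (∏ l ∈ {j}, v l) rfl) M (c (singletonIndex hi)) =
      localizedPowersMap (Dvd.intro_left (∏ l ∈ {i}, v l) rfl) M (c (singletonIndex hj)) := by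
  have key : ∀ (i j : ι) (hij : i ≠ j), ∏ l ∈ ({i, j} : Finset ι), v l =
      (∏ l ∈ {i}, v l) * ∏ l ∈ {j}, v l := fun i j hij => by
    rw [Finset.prod_pair hij, Finset.prod_singleton, Finset.prod_singleton]
  -- The product over `{i, j}` and the product of two factors are equal but give different
  -- localization types; `aux` carries the equation from one to the other.
  have aux : ∀ {a b r r' : R} (hr : r = r') (h1 : a ∣ r) (h2 : b ∣ r) (h1' : a ∣ r')
      (h2' : b ∣ r') (x : LocalizedModule (Submonoid.powers a) M)
      (y : LocalizedModule (Submonoid.powers b) M),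
      localizedPowersMap h1 M x = localizedPowersMap h2 M y ↔
      localizedPowersMap h1' M x = localizedPowersMap h2' M y := by
    intro a b r r' hr
    subst hr
    exact fun _ _ _ _ _ _ => Iff.rfl
  rw [LinearMap.mem_ker]
  constructor
  · intro h
    have hlt : ∀ (i j : ι) (hi : i ∈ u) (hj : j ∈ u), i < j →
      localizedPowersMap (Finset.prod_dvd_prod_of_subset {i} {i, j} v (by simp)) M
        (c (singletonIndex hi)) =
      localizedPowersMap (Finset.prod_dvd_prod_of_subset {j} {i, j} v (by simp)) M
        (c (singletonIndex hj)) := fun i j hi hj hij => by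
      rw [eq_comm, ← sub_eq_zero, ← cechD_one_apply v c hi hj hij, h, Pi.zero_apply]
    intro i j hi hj hij
    rcases hij.lt_or_gt with hij | hij
    · exact (aux (key i j hij.ne) _ _ _ _ _ _).1 (hlt i j hi hj hij)
    · exact (aux ((key j i hij.ne).trans (mul_comm _ _)) _ _ _ _ _ _).1
        (hlt j i hj hi hij).symm
  · intro h
    funext ⟨s, hs, hc⟩
    obtain ⟨i, j, hne, rfl⟩ := Finset.card_eq_two.1 hc
    -- The differential is computed for ordered pairs only, whereas a set of two elements comes
    -- unordered.
    wlog hij : i < j generalizing i j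
    · have := this j i hne.symm (by rwa [Finset.pair_comm]) (by rwa [Finset.pair_comm])
        (lt_of_le_of_ne (not_lt.1 hij) hne.symm)
      convert this using 2 <;> simp [Finset.pair_comm i j]
    have hi : i ∈ u := hs (by simp)
    have hj : j ∈ u := hs (by simp)
    refine (cechD_one_apply v c hi hj hij).trans (sub_eq_zero.2 ?_)
    exact ((aux (key i j hij.ne) _ _ _ _ _ _).2 (h i j hi hj hij.ne)).symm

end LowDegree

/-! ### Cohomology in degrees 0 and 1, and the edge isomorphism. -/

section LowDegreeCohomology

variable {R : Type*} [CommRing R] {ι : Type*} [LinearOrder ι] (v : ι → R)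
  {M : Type*} [AddCommGroup M] [Module R M] {u u' w : Finset ι}

theorem CechH.mk_surjective (u : Finset ι) (p : ℕ) (M : Type*) [AddCommGroup M] [Module R M] :
    Function.Surjective (CechH.mk v u p M) :=
  Submodule.mkQ_surjective _

theorem CechH.mk_eq_zero_iff {p : ℕ} (c : LinearMap.ker (cechD v u p M)) :
    CechH.mk v u p M c = 0 ↔ c.1 ∈ cechB v u M p :=
  Submodule.Quotient.mk_eq_zero _

theorem CechCochain.ext_zero {c c' : CechCochain v u 0 M}
    (h : c (emptyIndex u) = c' (emptyIndex u)) : c = c' := by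
  funext ⟨s, hs, hc⟩
  obtain rfl := Finset.card_eq_zero.1 hc
  exact h

theorem CechCochain.ext_one {c c' : CechCochain v u 1 M}
    (h : ∀ (i : ι) (hi : i ∈ u), c (singletonIndex hi) = c' (singletonIndex hi)) : c = c' := by
  funext ⟨s, hs, hc⟩
  obtain ⟨i, rfl⟩ := Finset.card_eq_one.1 hc
  exact h i (Finset.singleton_subset_iff.1 hs)

theorem CechCochain.exists_zero (x : LocalizedModule (Submonoid.powers (∏ i ∈ ∅, v i)) M) :
    ∃ c : CechCochain v u 0 M, c (emptyIndex u) = x := by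
  have h : ∀ s : {s : Finset ι // s ⊆ u ∧ s.card = 0},
      ∃ y : LocalizedModule (Submonoid.powers (∏ i ∈ s.1, v i)) M, y ≍ x := by
    rintro ⟨s, hs, hc⟩
    obtain rfl := Finset.card_eq_zero.1 hc
    exact ⟨x, HEq.rfl⟩
  choose c hc using h
  exact ⟨c, eq_of_heq (hc _)⟩

theorem CechCochain.exists_one
    (x : ∀ i ∈ u, LocalizedModule (Submonoid.powers (∏ l ∈ {i}, v l)) M) :
    ∃ c : CechCochain v u 1 M, ∀ (i : ι) (hi : i ∈ u), c (singletonIndex hi) = x i hi := by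
  have h : ∀ s : {s : Finset ι // s ⊆ u ∧ s.card = 1},
      ∃ y : LocalizedModule (Submonoid.powers (∏ i ∈ s.1, v i)) M,
        ∀ (i : ι) (hi : i ∈ u), s = singletonIndex hi → y ≍ x i hi := by
    rintro ⟨s, hs, hc⟩
    obtain ⟨i, rfl⟩ := Finset.card_eq_one.1 hc
    refine ⟨x i (Finset.singleton_subset_iff.1 hs), fun j hj h => ?_⟩
    obtain rfl := Finset.singleton_injective (congrArg Subtype.val h)
    rfl
  choose c hc using h
  exact ⟨c, fun i hi => eq_of_heq (hc _ i hi rfl)⟩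

theorem smul_prod_empty_injective {m : M} (h : (∏ i ∈ (∅ : Finset ι), v i) • m = 0) : m = 0 := by
  simpa using h

theorem toLocalizedPowers_prod_empty_surjective :
    Function.Surjective (toLocalizedPowers (∏ i ∈ (∅ : Finset ι), v i) M) := by
  intro x
  obtain ⟨e, m, h⟩ := exists_pow_smul_eq_toLocalizedPowers x
  refine ⟨m, h.symm.trans ?_⟩
  have : (∏ i ∈ (∅ : Finset ι), v i) ^ e = 1 := by simp
  rw [this, one_smul]

theorem toLocalizedPowers_cechHZeroToModule (c : LinearMap.ker (cechD v u 0 M)) :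
    toLocalizedPowers _ M (cechHZeroToModule v u M (CechH.mk v u 0 M c)) =
      c.1 (emptyIndex u) := by
  obtain ⟨m, hm⟩ := toLocalizedPowers_prod_empty_surjective v (c.1 (emptyIndex u))
  have hu : ∀ x : Submonoid.powers (∏ i ∈ (∅ : Finset ι), v i),
      IsUnit (algebraMap R (Module.End R M) x) := by
    rintro ⟨_, n, rfl⟩
    simp
  have h : cechHZeroToModule v u M (CechH.mk v u 0 M c) = m := by
    change LocalizedModule.lift _ LinearMap.id hu (c.1 (emptyIndex u)) = m
    rw [← hm]
    exact LocalizedModule.lift_mk_one _ _ _ m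
  rw [← hm, h]

theorem cechHZeroToModule_injective :
    Function.Injective (cechHZeroToModule v u M) := by
  rw [injective_iff_map_eq_zero]
  intro z hz
  obtain ⟨c, rfl⟩ := CechH.mk_surjective v u 0 M z
  rw [CechH.mk_eq_zero_iff]
  have h := toLocalizedPowers_cechHZeroToModule v c
  rw [hz, map_zero] at h
  exact CechCochain.ext_zero v h.symm

/-- `H^0_𝔞(M)` is the `𝔞`-power torsion of `M`. -/
theorem mem_range_cechHZeroToModule_iff (m : M) :
    m ∈ LinearMap.range (cechHZeroToModule v u M) ↔
      ∀ i ∈ u, ∃ e : ℕ, (∏ l ∈ ({i} : Finset ι), v l) ^ e • m = 0 := by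
  constructor
  · rintro ⟨z, rfl⟩ i hi
    obtain ⟨c, rfl⟩ := CechH.mk_surjective v u 0 M z
    have h := (mem_ker_cechD_zero_iff v c.1).1 c.2 i hi
    rw [← toLocalizedPowers_cechHZeroToModule, localizedPowersMap_toLocalizedPowers] at h
    exact toLocalizedPowers_eq_zero_iff.1 h
  · intro h
    obtain ⟨c, hc⟩ := CechCochain.exists_zero (u := u) v
      (toLocalizedPowers (∏ i ∈ (∅ : Finset ι), v i) M m)
    have hker : c ∈ LinearMap.ker (cechD v u 0 M) := by
      rw [mem_ker_cechD_zero_iff]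
      intro i hi
      rw [hc, localizedPowersMap_toLocalizedPowers]
      exact toLocalizedPowers_eq_zero_iff.2 (h i hi)
    refine ⟨CechH.mk v u 0 M ⟨c, hker⟩, ?_⟩
    exact toLocalizedPowers_injective (fun _ => smul_prod_empty_injective v)
      ((toLocalizedPowers_cechHZeroToModule v ⟨c, hker⟩).trans hc)

theorem CechH.mk_one_eq_zero_iff (c : LinearMap.ker (cechD v u 1 M)) :
    CechH.mk v u 1 M c = 0 ↔ ∃ m : M, ∀ (i : ι) (hi : i ∈ u),
      c.1 (singletonIndex hi) = toLocalizedPowers _ M m := by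
  rw [CechH.mk_eq_zero_iff]
  constructor
  · rintro ⟨b, hb⟩
    obtain ⟨m, hm⟩ := toLocalizedPowers_prod_empty_surjective v (b (emptyIndex u))
    refine ⟨m, fun i hi => ?_⟩
    rw [← hb, cechD_zero_apply, ← hm, localizedPowersMap_toLocalizedPowers]
  · rintro ⟨m, hm⟩
    obtain ⟨b, hb⟩ := CechCochain.exists_zero (u := u) v
      (toLocalizedPowers (∏ i ∈ (∅ : Finset ι), v i) M m)
    refine ⟨b, CechCochain.ext_one v fun i hi => ?_⟩
    rw [cechD_zero_apply, hb, localizedPowersMap_toLocalizedPowers, hm]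

theorem subsingleton_cechH_one (h : ∀ i ∈ u, ∀ m : M, v i • m = 0) :
    Subsingleton (CechH v u 1 M) := by
  refine subsingleton_of_forall_eq 0 fun z => ?_
  obtain ⟨c, rfl⟩ := CechH.mk_surjective v u 1 M z
  refine (CechH.mk_one_eq_zero_iff v c).2 ⟨0, fun i hi => ?_⟩
  have := subsingleton_localizedPowers (M := M) (a := ∏ l ∈ ({i} : Finset ι), v l)
    (by simpa using h i hi)
  exact Subsingleton.elim _ _

/-- If `c` is the coboundary of `m` on `u`, then `c_a = m`, so the cocycle condition gives `c_i = m`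
in `M_{v_a v_i}` for every other `i`. As `v_a` is regular, `M_{v_i}` embeds there. -/
theorem cechRestrict_one_injective (h : u ⊆ u') {a : ι} (hau : a ∈ u)
    (ha : ∀ m : M, v a • m = 0 → m = 0) :
    Function.Injective (cechRestrict v h 1 M) := by
  rw [injective_iff_map_eq_zero]
  intro z hz
  obtain ⟨c, rfl⟩ := CechH.mk_surjective v u' 1 M z
  obtain ⟨m, hm⟩ := (CechH.mk_one_eq_zero_iff v _).1 hz
  refine (CechH.mk_one_eq_zero_iff v c).2 ⟨m, fun i hi => ?_⟩
  by_cases hiu : i ∈ u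
  · exact hm i hiu
  have hne : a ≠ i := fun h => hiu (h ▸ hau)
  have h1 := (mem_ker_cechD_one_iff v c.1).1 c.2 a i (h hau) hi hne
  have h2 : c.1 (singletonIndex (h hau)) = toLocalizedPowers _ M m := hm a hau
  rw [h2, localizedPowersMap_toLocalizedPowers] at h1
  refine localizedPowersMap_injective rfl (by simpa using ha)
    (Dvd.intro_left (∏ l ∈ {a}, v l) rfl) ?_
  rw [← h1, localizedPowersMap_toLocalizedPowers]

/-- The image of `H^1_{𝔞+𝔟}(M) → H^1_𝔞(M)` is `𝔟`-power torsion. -/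
theorem exists_pow_smul_cechRestrict_one_eq_zero (h : u ⊆ u') (z : CechH v u' 1 M) {j : ι}
    (hj : j ∈ u') (hju : j ∉ u) :
    ∃ e : ℕ, (∏ l ∈ ({j} : Finset ι), v l) ^ e • cechRestrict v h 1 M z = 0 := by
  obtain ⟨c, rfl⟩ := CechH.mk_surjective v u' 1 M z
  set b := ∏ l ∈ ({j} : Finset ι), v l with hb
  obtain ⟨e, m, hm⟩ := exists_pow_smul_eq_toLocalizedPowers (c.1 (singletonIndex hj))
  -- With `c_j = m / b ^ e`, agreement of `c_i` and `c_j` says that `b ^ (N + e) • c_i = b ^ N • m`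
  -- once `N` is large. Stated eventually in `N`, so that one exponent serves the finitely many `i ∈
  -- u`.
  have key : ∀ i ∈ u, ∀ᶠ N : ℕ in Filter.atTop, ∀ hi : i ∈ u,
      b ^ (N + e) • c.1 (singletonIndex (h hi)) = toLocalizedPowers _ M (b ^ N • m) := by
    intro i hi
    have hne : i ≠ j := fun h => hju (h ▸ hi)
    obtain ⟨f, m', hm'⟩ := exists_pow_smul_eq_toLocalizedPowers (c.1 (singletonIndex (h hi)))
    have h1 := (mem_ker_cechD_one_iff v c.1).1 c.2 i j (h hi) hj hne
    rw [localizedPowersMap_eq_iff _ _ hm' hm, ← sub_eq_zero, ← map_sub,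
      toLocalizedPowers_eq_zero_iff] at h1
    obtain ⟨N, hN⟩ := h1
    refine Filter.eventually_atTop.2 ⟨N, fun N' hN' _ => ?_⟩
    obtain ⟨q, rfl⟩ := Nat.exists_eq_add_of_le hN'
    refine pow_smul_localizedPowers_injective dvd_rfl (f + N) ?_
    rw [mul_pow, smul_sub, sub_eq_zero] at hN
    set a := ∏ l ∈ ({i} : Finset ι), v l
    calc a ^ (f + N) • b ^ (N + q + e) • c.1 (singletonIndex (h hi))
        = (b ^ q * (a ^ N * b ^ N) * b ^ e) • a ^ f • c.1 (singletonIndex (h hi)) := by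
          simp only [smul_smul]
          congr 1
          ring
      _ = toLocalizedPowers a M (b ^ q • (a ^ N * b ^ N) • b ^ e • m') := by
          rw [hm', ← map_smul, mul_smul, mul_smul]
      _ = toLocalizedPowers a M (a ^ (f + N) • b ^ (N + q) • m) := by
          rw [hN]
          congr 1
          simp only [smul_smul]
          congr 1
          ring
      _ = a ^ (f + N) • toLocalizedPowers a M (b ^ (N + q) • m) := map_smul _ _ _
  obtain ⟨N, hN⟩ := ((Filter.eventually_all_finset u).2 key).exists
  refine ⟨N + e, ?_⟩
  change CechH.mk v u 1 M (b ^ (N + e) • _) = 0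
  exact (CechH.mk_one_eq_zero_iff v _).2 ⟨b ^ N • m, fun i hi => hN i hi hi⟩

/-- For `j` outside `u`, torsion makes `v_j ^ e_j • c` the coboundary of some `m_j`, and `m_j / v_j
^ e_j` is the missing component at `j`. Regularity of `v_a` is needed only to compare two new
components. -/
theorem exists_cechRestrict_one_eq (h : u ⊆ u') {a : ι} (hau : a ∈ u)
    (ha : ∀ m : M, v a • m = 0 → m = 0) (y : CechH v u 1 M)
    (hy : ∀ j ∈ u', j ∉ u → ∃ e : ℕ, (∏ l ∈ ({j} : Finset ι), v l) ^ e • y = 0) :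
    ∃ z, cechRestrict v h 1 M z = y := by
  obtain ⟨c, rfl⟩ := CechH.mk_surjective v u 1 M y
  have hy' : ∀ j, ∃ (e : ℕ) (m : M), j ∈ u' → j ∉ u → ∀ (i : ι) (hi : i ∈ u),
      (∏ l ∈ ({j} : Finset ι), v l) ^ e • c.1 (singletonIndex hi) =
        toLocalizedPowers _ M m := by
    intro j
    by_cases hj : j ∈ u' ∧ j ∉ u
    · obtain ⟨e, he⟩ := hy j hj.1 hj.2
      rw [← map_smul] at he
      obtain ⟨m, hm⟩ := (CechH.mk_one_eq_zero_iff v _).1 he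
      exact ⟨e, m, fun _ _ => hm⟩
    -- Dummy values, so that `choose` yields functions on all of `ι`.
    · exact ⟨0, 0, fun h1 h2 => absurd ⟨h1, h2⟩ hj⟩
  choose e m hm using hy'
  have hF : ∀ j, j ∈ u' → ∃ x : LocalizedModule (Submonoid.powers (∏ l ∈ {j}, v l)) M,
      (∀ hj : j ∈ u, x = c.1 (singletonIndex hj)) ∧
      (j ∉ u → (∏ l ∈ ({j} : Finset ι), v l) ^ e j • x = toLocalizedPowers _ M (m j)) := by
    intro j _
    by_cases hj : j ∈ u
    · exact ⟨c.1 (singletonIndex hj), fun _ => rfl, fun h => absurd hj h⟩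
    · obtain ⟨x, hx⟩ := exists_pow_smul_eq (∏ l ∈ ({j} : Finset ι), v l) (m j) (e j)
      exact ⟨x, fun h => absurd h hj, fun _ => hx⟩
  choose F hFu hFw using hF
  obtain ⟨c', hc'⟩ := CechCochain.exists_one v F
  have mixed : ∀ (i j : ι) (hi : i ∈ u') (hj : j ∈ u') (r : R)
      (h1 : ∏ l ∈ ({i} : Finset ι), v l ∣ r) (h2 : ∏ l ∈ ({j} : Finset ι), v l ∣ r),
      i ∈ u → j ∉ u → localizedPowersMap h1 M (F i hi) = localizedPowersMap h2 M (F j hj) := by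
    intro i j hi hj r h1 h2 hiu hju
    refine pow_smul_localizedPowers_injective h2 (e j) ?_
    rw [← map_smul, ← map_smul, hFw j hj hju, hFu i hi hiu, hm j hj hju i hiu,
      localizedPowersMap_toLocalizedPowers, localizedPowersMap_toLocalizedPowers]
  have hker : c' ∈ LinearMap.ker (cechD v u' 1 M) := by
    rw [mem_ker_cechD_one_iff]
    intro i j hi hj hij
    rw [hc', hc']
    by_cases hiu : i ∈ u <;> by_cases hju : j ∈ u
    · rw [hFu i hi hiu, hFu j hj hju]
      exact (mem_ker_cechD_one_iff v c.1).1 c.2 i j hiu hju hij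
    · exact mixed i j hi hj _ _ _ hiu hju
    · exact (mixed j i hj hi _ _ _ hju hiu).symm
    · rw [localizedPowersMap_eq_iff _ _ (hFw i hi hiu) (hFw j hj hju)]
      congr 1
      -- The required identity between `m_i` and `m_j` is checked in `M_{v_a}`, which contains `M`;
      -- there both sides are the same multiple of `c_a`.
      refine toLocalizedPowers_injective (a := ∏ l ∈ ({a} : Finset ι), v l) (by simpa using ha) ?_
      rw [map_smul, map_smul, ← hm i hi hiu a hau, ← hm j hj hju a hau, smul_comm]
  refine ⟨CechH.mk v u' 1 M ⟨c', hker⟩, ?_⟩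
  change CechH.mk v u 1 M _ = CechH.mk v u 1 M c
  congr 1
  refine Subtype.ext (CechCochain.ext_one v fun i hi => ?_)
  exact (hc' i (h hi)).trans (hFu i (h hi) hi)

/-- If `𝔞` contains a nonzerodivisor on `M` among its generators, then
`H^1_{𝔞+𝔟}(M) ≃ H^0_𝔟(H^1_𝔞(M))`. -/
def cechEdgeEquiv (h : u ⊆ u') (hw : ∀ i, i ∈ w ↔ i ∈ u' ∧ i ∉ u) {a : ι} (hau : a ∈ u)
    (ha : ∀ m : M, v a • m = 0 → m = 0) :
    CechH v u' 1 M ≃ₗ[R] CechH v w 0 (CechH v u 1 M) :=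
  -- Both modules embed in `H^1_𝔞(M)` with the same image, the `𝔟`-power torsion.
  (LinearEquiv.ofInjective _ (cechRestrict_one_injective v h hau ha)).trans
    ((LinearEquiv.ofEq _ _ (by
      ext y
      rw [mem_range_cechHZeroToModule_iff]
      constructor
      · rintro ⟨z, rfl⟩ j hj
        exact exists_pow_smul_cechRestrict_one_eq_zero v h z ((hw j).1 hj).1 ((hw j).1 hj).2
      · exact fun hy => exists_cechRestrict_one_eq v h hau ha y
          fun j hj hju => hy j ((hw j).2 ⟨hj, hju⟩))).trans
    (LinearEquiv.ofInjective _ (cechHZeroToModule_injective v)).symm)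

theorem cechHZeroToModule_cechEdgeEquiv (h : u ⊆ u') (hw : ∀ i, i ∈ w ↔ i ∈ u' ∧ i ∉ u) {a : ι}
    (hau : a ∈ u) (ha : ∀ m : M, v a • m = 0 → m = 0) (z : CechH v u' 1 M) :
    cechHZeroToModule v w _ (cechEdgeEquiv v h hw hau ha z) = cechRestrict v h 1 M z := by
  rw [cechEdgeEquiv, LinearEquiv.trans_apply, LinearEquiv.trans_apply,
    ← LinearEquiv.ofInjective_apply (cechHZeroToModule v w (CechH v u 1 M))
      (h := cechHZeroToModule_injective v), LinearEquiv.apply_symm_apply]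
  rfl

end LowDegreeCohomology

/-! ### Compatibility of the edge isomorphism with gradings. -/

section Grading

variable {R : Type*} [CommRing R] {ι : Type*} [LinearOrder ι] (v : ι → R)
  {M : Type*} [AddCommGroup M] [Module R M] {u u' w : Finset ι}
  {G : Type*} [AddCommGroup G] (deg : ι → G) {𝓜 : G → AddSubgroup M}

theorem pow_smul_mem_component {r : R} {ε : G}
    (h : ∀ δ, ∀ m ∈ 𝓜 δ, r • m ∈ 𝓜 (δ + ε)) (e : ℕ) {δ : G} {m : M} (hm : m ∈ 𝓜 δ) :
    r ^ e • m ∈ 𝓜 (δ + e • ε) := by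
  induction e with
  | zero => simpa using hm
  | succ e ih =>
    rw [pow_succ', mul_smul, succ_nsmul, ← add_assoc]
    exact h _ _ ih

theorem mem_component_of_pow_smul {r : R} {ε : G}
    (h : ∀ δ m, r • m ∈ 𝓜 (δ + ε) → m ∈ 𝓜 δ) (e : ℕ) {δ : G} {m : M}
    (hm : r ^ e • m ∈ 𝓜 (δ + e • ε)) : m ∈ 𝓜 δ := by
  induction e with
  | zero => simpa using hm
  | succ e ih =>
    rw [pow_succ', mul_smul, succ_nsmul, ← add_assoc] at hm
    exact ih (h _ _ hm)

/-- Homogeneous fractions of one degree are already closed under addition, by passing to a common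
denominator, so the subgroup closure adds nothing. -/
theorem mem_localizedComponent_iff {s : Finset ι}
    (h : ∀ δ, ∀ m ∈ 𝓜 δ, (∏ i ∈ s, v i) • m ∈ 𝓜 (δ + ∑ i ∈ s, deg i)) {δ : G}
    (x : LocalizedModule (Submonoid.powers (∏ i ∈ s, v i)) M) :
    x ∈ localizedComponent v deg s 𝓜 δ ↔ ∃ (e : ℕ) (m : M),
      m ∈ 𝓜 (δ + e • ∑ i ∈ s, deg i) ∧
        (∏ i ∈ s, v i) ^ e • x = toLocalizedPowers (∏ i ∈ s, v i) M m := by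
  have mk_spec : ∀ (e : ℕ) (m : M), (∏ i ∈ s, v i) ^ e •
      LocalizedModule.mk m ⟨(∏ i ∈ s, v i) ^ e, Submonoid.mem_powers_iff _ _ |>.2 ⟨e, rfl⟩⟩ =
        toLocalizedPowers (∏ i ∈ s, v i) M m := by
    intro e m
    rw [LocalizedModule.smul'_mk]
    exact LocalizedModule.mk_cancel (⟨(∏ i ∈ s, v i) ^ e, e, rfl⟩ : Submonoid.powers _) m
  constructor
  · intro hx
    induction hx using AddSubgroup.closure_induction with
    | mem x hx =>
      obtain ⟨e, m, hm, rfl⟩ := hx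
      exact ⟨e, m, hm, mk_spec e m⟩
    | zero => exact ⟨0, 0, zero_mem _, by simp⟩
    | add x y _ _ hx hy =>
      obtain ⟨e, m, hm, hx⟩ := hx
      obtain ⟨f, m', hm', hy⟩ := hy
      refine ⟨e + f, (∏ i ∈ s, v i) ^ f • m + (∏ i ∈ s, v i) ^ e • m', ?_, ?_⟩
      · refine add_mem ?_ ?_
        · rw [add_nsmul, ← add_assoc]
          exact pow_smul_mem_component h f hm
        · rw [add_comm e, add_nsmul, ← add_assoc]
          exact pow_smul_mem_component h e hm'
      · rw [map_add, map_smul, map_smul, ← hx, ← hy, smul_smul, smul_smul, ← pow_add, ← pow_add,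
          add_comm f, smul_add]
    | neg x _ hx =>
      obtain ⟨e, m, hm, hx⟩ := hx
      exact ⟨e, -m, neg_mem hm, by rw [smul_neg, hx, map_neg]⟩
  · rintro ⟨e, m, hm, hx⟩
    refine AddSubgroup.subset_closure ⟨e, m, hm, ?_⟩
    exact pow_smul_localizedPowers_injective dvd_rfl e (hx.trans (mk_spec e m).symm)

theorem cechHZeroToModule_mem_iff {δ : G} (z : CechH v u 0 M) :
    cechHZeroToModule v u M z ∈ 𝓜 δ ↔ z ∈ cechHComponent v deg u 0 𝓜 δ := by
  have hs : ∀ δ, ∀ m ∈ 𝓜 δ, (∏ i ∈ (∅ : Finset ι), v i) • m ∈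
      𝓜 (δ + ∑ i ∈ (∅ : Finset ι), deg i) := fun δ m hm => by simpa using hm
  constructor
  · intro hz
    obtain ⟨c, rfl⟩ := CechH.mk_surjective v u 0 M z
    refine ⟨c, ?_, rfl⟩
    rintro ⟨s, hs', hc⟩ -
    obtain rfl := Finset.card_eq_zero.1 hc
    refine (mem_localizedComponent_iff v deg hs _).2 ⟨0, _, by simpa using hz, ?_⟩
    rw [pow_zero, one_smul]
    exact (toLocalizedPowers_cechHZeroToModule v c).symm
  · rintro ⟨c, hc, rfl⟩
    obtain ⟨e, m, hm, hx⟩ := (mem_localizedComponent_iff v deg hs _).1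
      (hc (emptyIndex u) (Set.mem_univ _))
    have h1 : (∏ i ∈ (∅ : Finset ι), v i) ^ e = 1 := by simp
    rw [h1, one_smul] at hx
    have h2 := toLocalizedPowers_injective (fun _ => smul_prod_empty_injective v)
      ((toLocalizedPowers_cechHZeroToModule v c).trans hx)
    have h3 : cechHZeroToModule v u M (CechH.mk v u 0 M c) ∈ 𝓜 δ := by
      rw [h2]
      simpa using hm
    exact h3

/-- The substance is that degrees are reflected. A cocycle whose restriction is cohomologous to a
homogeneous `b` is corrected by a coboundary until it equals `b` on `u`; its other components are
then homogeneous by comparison with the one at `a`. -/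
theorem cechRestrict_one_mem_iff (h : u ⊆ u') {a : ι} (hau : a ∈ u)
    (ha : ∀ m : M, v a • m = 0 → m = 0)
    (hmul : ∀ i δ, ∀ m ∈ 𝓜 δ, v i • m ∈ 𝓜 (δ + deg i))
    (hdeg : ∀ δ m, v a • m ∈ 𝓜 (δ + deg a) → m ∈ 𝓜 δ) {δ : G} (z : CechH v u' 1 M) :
    cechRestrict v h 1 M z ∈ cechHComponent v deg u 1 𝓜 δ ↔
      z ∈ cechHComponent v deg u' 1 𝓜 δ := by
  have hs : ∀ i δ, ∀ m ∈ 𝓜 δ, (∏ l ∈ ({i} : Finset ι), v l) • m ∈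
      𝓜 (δ + ∑ l ∈ ({i} : Finset ι), deg l) := fun i δ m hm => by simpa using hmul i δ m hm
  constructor
  · rintro ⟨b, hb, hbz⟩
    obtain ⟨c, rfl⟩ := CechH.mk_surjective v u' 1 M z
    have hdiff := sub_eq_zero.2 hbz
    change CechH.mk v u 1 M (b - _) = 0 at hdiff
    obtain ⟨m, hm⟩ := (CechH.mk_one_eq_zero_iff v _).1 hdiff
    obtain ⟨m₀, hm₀⟩ := CechCochain.exists_zero (u := u') v
      (toLocalizedPowers (∏ i ∈ (∅ : Finset ι), v i) M m)
    have hbound : ∀ (i : ι) (hi : i ∈ u'),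
        cechD v u' 0 M m₀ (singletonIndex hi) = toLocalizedPowers _ M m := fun i hi => by
      rw [cechD_zero_apply, hm₀, localizedPowersMap_toLocalizedPowers]
    have hbker : cechD v u' 0 M m₀ ∈ LinearMap.ker (cechD v u' 1 M) := by
      rw [mem_ker_cechD_one_iff]
      intro i j hi hj hij
      rw [hbound, hbound, localizedPowersMap_toLocalizedPowers,
        localizedPowersMap_toLocalizedPowers]
    -- Here `b - c` is the coboundary of `m` on `u`; adding the coboundary of `m` on all of `u'`
    -- keeps the class of `c`.
    set c' : LinearMap.ker (cechD v u' 1 M) := c + ⟨_, hbker⟩ with hc'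
    have hcu : ∀ (i : ι) (hi : i ∈ u), c'.1 (singletonIndex (h hi)) = b.1 (singletonIndex hi) := by
      intro i hi
      have h1 : b.1 (singletonIndex hi) - c.1 (singletonIndex (h hi)) =
        toLocalizedPowers _ M m := hm i hi
      change c.1 (singletonIndex (h hi)) + cechD v u' 0 M m₀ (singletonIndex (h hi)) = _
      rw [hbound, ← h1, add_sub_cancel]
    have hmk : CechH.mk v u' 1 M c' = CechH.mk v u' 1 M c := by
      rw [hc', map_add, (CechH.mk_eq_zero_iff v ⟨_, hbker⟩).2 ⟨m₀, rfl⟩, add_zero]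
    refine ⟨c', ?_, hmk⟩
    rintro ⟨s, hsu, hsc⟩ -
    obtain ⟨j, rfl⟩ := Finset.card_eq_one.1 hsc
    have hj := Finset.singleton_subset_iff.1 hsu
    change c'.1 (singletonIndex hj) ∈ _
    by_cases hju : j ∈ u
    · rw [hcu j hju]
      exact hb (singletonIndex hju) (Set.mem_univ _)
    have hne : a ≠ j := fun h => hju (h ▸ hau)
    have h1 := (mem_ker_cechD_one_iff v c'.1).1 c'.2 a j (h hau) hj hne
    obtain ⟨e, x, hx⟩ := exists_pow_smul_eq_toLocalizedPowers (c'.1 (singletonIndex hj))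
    obtain ⟨f, y, hy, hyb⟩ := (mem_localizedComponent_iff v deg (hs a) _).1
      (hb (singletonIndex hau) (Set.mem_univ _))
    replace hyb : _ • b.1 (singletonIndex hau) = _ := hyb
    rw [← hcu] at hyb
    rw [localizedPowersMap_eq_iff _ _ hyb hx, ← sub_eq_zero, ← map_sub,
      toLocalizedPowers_eq_zero_iff] at h1
    obtain ⟨N, hN⟩ := h1
    rw [mul_pow, mul_smul] at hN
    have ha' : ∀ m : M, (∏ l ∈ ({a} : Finset ι), v l) • m = 0 → m = 0 := by simpa using ha
    have hdeg' : ∀ δ m, (∏ l ∈ ({a} : Finset ι), v l) • m ∈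
        𝓜 (δ + ∑ l ∈ ({a} : Finset ι), deg l) → m ∈ 𝓜 δ := by simpa using hdeg
    have h2 := pow_smul_eq_zero_of_regular ha' N hN
    rw [smul_sub, sub_eq_zero, smul_comm] at h2
    refine (mem_localizedComponent_iff v deg (hs j) _).2
      ⟨N + e, (∏ l ∈ ({j} : Finset ι), v l) ^ N • x, ?_, ?_⟩
    -- By `h2`, `v_a ^ f • (v_j ^ N • x)` equals `v_j ^ (N + e) • y`, whose degree is known;
    -- dividing by `v_a ^ f` gives the degree of the numerator.
    · refine mem_component_of_pow_smul hdeg' f ?_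
      rw [smul_comm, ← h2, smul_comm, smul_smul, ← pow_add, add_right_comm]
      exact pow_smul_mem_component (hs j) (N + e) hy
    · rw [pow_add, mul_smul, hx, map_smul]
  · rintro ⟨c, hc, rfl⟩
    refine ⟨(cechRestrictCochain v h 1 M).restrict (fun c hc => by
      rw [LinearMap.mem_ker] at hc ⊢
      rw [cechD_cechRestrictCochain, hc, map_zero]) c, fun s _ => ?_, rfl⟩
    exact hc ⟨s.1, s.2.1.trans h, s.2.2⟩ (Set.mem_univ _)

theorem cechEdgeEquiv_mem_iff (h : u ⊆ u') (hw : ∀ i, i ∈ w ↔ i ∈ u' ∧ i ∉ u) {a : ι}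
    (hau : a ∈ u) (ha : ∀ m : M, v a • m = 0 → m = 0)
    (hmul : ∀ i δ, ∀ m ∈ 𝓜 δ, v i • m ∈ 𝓜 (δ + deg i))
    (hdeg : ∀ δ m, v a • m ∈ 𝓜 (δ + deg a) → m ∈ 𝓜 δ) (δ : G) (z : CechH v u' 1 M) :
    cechEdgeEquiv v h hw hau ha z ∈
        cechHComponent v deg w 0 (cechHComponent v deg u 1 𝓜) δ ↔
      z ∈ cechHComponent v deg u' 1 𝓜 δ := by
  rw [← cechHZeroToModule_mem_iff, cechHZeroToModule_cechEdgeEquiv,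
    cechRestrict_one_mem_iff v deg h hau ha hmul hdeg]

end Grading

/-! ### Regularity and degrees of the variables on the Rees module. -/

section Rees

theorem homogeneousComponent_mul_of_left {σ K : Type*} [CommSemiring K] {h : MvPolynomial σ K}
    {e : ℕ} (hh : h.IsHomogeneous e) (i : ℕ) (q : MvPolynomial σ K) :
    MvPolynomial.homogeneousComponent (e + i) (h * q) =
      h * MvPolynomial.homogeneousComponent i q := by
  classical
  conv_lhs => rw [← MvPolynomial.sum_homogeneousComponent q, Finset.mul_sum, map_sum]
  have h1 : ∀ j, MvPolynomial.homogeneousComponent (e + i)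
      (h * MvPolynomial.homogeneousComponent j q) =
        if j = i then h * MvPolynomial.homogeneousComponent i q else 0 := by
    intro j
    rw [MvPolynomial.homogeneousComponent_of_mem
      (hh.mul (MvPolynomial.homogeneousComponent_isHomogeneous j q))]
    by_cases hj : j = i
    · simp [hj]
    · rw [if_neg hj, if_neg (by omega)]
  simp only [h1, Finset.sum_ite_eq', Finset.mem_range]
  by_cases hi : i < q.totalDegree + 1
  · rw [if_pos hi]
  · rw [if_neg hi, MvPolynomial.homogeneousComponent_eq_zero _ _ (by omega), mul_zero]

/-- A cofactor of a nonzero form in a form is a form. -/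
theorem MvPolynomial.IsHomogeneous.exists_of_mul {σ K : Type*} [CommRing K] [IsDomain K]
    {h q : MvPolynomial σ K} {e ν : ℕ} (hh : h.IsHomogeneous e) (h0 : h ≠ 0)
    (hq : (h * q).IsHomogeneous ν) (q0 : q ≠ 0) : ∃ i, ν = e + i ∧ q.IsHomogeneous i := by
  have key : ∀ i, MvPolynomial.homogeneousComponent i q ≠ 0 → ν = e + i := by
    intro i hi
    by_contra hne
    have h1 := homogeneousComponent_mul_of_left hh i q
    rw [MvPolynomial.homogeneousComponent_of_mem hq, if_neg (Ne.symm hne)] at h1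
    exact mul_ne_zero h0 hi h1.symm
  have hex : ∃ i, MvPolynomial.homogeneousComponent i q ≠ 0 := by
    by_contra! hall
    apply q0
    rw [← MvPolynomial.sum_homogeneousComponent q]
    exact Finset.sum_eq_zero fun i _ => hall i
  obtain ⟨i, hi⟩ := hex
  refine ⟨i, key i hi, ?_⟩
  rw [← MvPolynomial.sum_homogeneousComponent q]
  refine MvPolynomial.IsHomogeneous.sum _ _ _ fun j _ => ?_
  by_cases hj : MvPolynomial.homogeneousComponent j q = 0
  · rw [hj]
    exact MvPolynomial.isHomogeneous_zero _ _ _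
  · have h1 := key i hi
    have h2 := key j hj
    obtain rfl : j = i := by omega
    exact MvPolynomial.homogeneousComponent_isHomogeneous _ _

variable {k : Type*} [Field k] {n m : ℕ} {I : Ideal (MvPolynomial (Fin n) k)}
  {g : Fin m → MvPolynomial (Fin n) k} {hg : ∀ j, g j ∈ I} {d : ℕ}

theorem ReesModule.toPoly_injective :
    Function.Injective (ReesModule.toPoly : ReesModule I g hg →+ _) :=
  Subtype.val_injective

theorem ReesModule.toPoly_smul (s : MvPolynomial (Fin m) (MvPolynomial (Fin n) k))
    (f : ReesModule I g hg) :
    (s • f).toPoly = (reesMap I g hg s : (MvPolynomial (Fin n) k)[X]) * f.toPoly :=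
  rfl

theorem ReesModule.toPoly_x_smul (a : Fin n) (f : ReesModule I g hg) :
    (biVar k n m (toLex (Sum.inl a)) • f).toPoly =
      Polynomial.monomial 0 (MvPolynomial.X a) * f.toPoly := by
  rw [ReesModule.toPoly_smul]
  congr 1
  change ((reesMap I g hg (MvPolynomial.C (MvPolynomial.X a)) : reesAlgebra I) :
    (MvPolynomial (Fin n) k)[X]) = _
  rw [reesMap, MvPolynomial.aeval_C]
  rfl

theorem ReesModule.toPoly_t_smul (j : Fin m) (f : ReesModule I g hg) :
    (biVar k n m (toLex (Sum.inr j)) • f).toPoly =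
      Polynomial.monomial 1 (g j) * f.toPoly := by
  rw [ReesModule.toPoly_smul]
  congr 1
  change ((reesMap I g hg (MvPolynomial.X j) : reesAlgebra I) :
    (MvPolynomial (Fin n) k)[X]) = _
  rw [reesMap, MvPolynomial.aeval_X]

/-- `A[X]` is a domain. The shape `monomial r h` covers `x_i` (`r = 0`, `h = x_i`) and `T_j` (`r =
1`, `h = g_j`) at once, here and in the degree lemmas. -/
theorem ReesModule.eq_zero_of_toPoly_smul {s : MvPolynomial (Fin m) (MvPolynomial (Fin n) k)}
    {r : ℕ} {h : MvPolynomial (Fin n) k} (h0 : h ≠ 0)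
    (hs : ∀ f : ReesModule I g hg, (s • f).toPoly = Polynomial.monomial r h * f.toPoly)
    (f : ReesModule I g hg) (hf : s • f = 0) : f = 0 := by
  have h1 := hs f
  rw [hf, map_zero, eq_comm, mul_eq_zero, Polynomial.monomial_eq_zero_iff] at h1
  exact ReesModule.toPoly_injective ((h1.resolve_left h0).trans (map_zero _).symm)

theorem ReesModule.mem_component_iff (δ : ℤ × ℤ) (f : ReesModule I g hg) :
    f ∈ ReesModule.component I g hg d δ ↔ ∀ t : ℕ, f.toPoly.coeff t ≠ 0 →
      (t : ℤ) = δ.2 ∧ ∃ ν : ℕ, (ν : ℤ) = δ.1 + t * d ∧ (f.toPoly.coeff t).IsHomogeneous ν := by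
  constructor
  · intro hf t ht
    obtain ⟨w, hw⟩ := MvPolynomial.ne_zero_iff.1 ht
    obtain ⟨h1, h2⟩ := hf t w hw
    refine ⟨h1, w.degree, h2, fun w' hw' => ?_⟩
    have h3 := (hf t w' hw').2
    exact (DFunLike.congr_fun Finsupp.degree_eq_weight_one w').symm.trans
      (by exact_mod_cast h3.trans h2.symm)
  · intro hf t w hw
    obtain ⟨h1, ν, h2, h3⟩ := hf t (MvPolynomial.ne_zero_iff.2 ⟨w, hw⟩)
    refine ⟨h1, ?_⟩
    rw [← h2, ← h3 hw]
    exact congrArg _ (DFunLike.congr_fun Finsupp.degree_eq_weight_one w)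

/-- The twist by `td` turns multiplication by `h X ^ r` into a shift by `(e - r d, r)`: this is `(1,
0)` for `x_i`, and `(0, 1)` for `T_j` because `g_j` has degree exactly `d`. -/
theorem ReesModule.smul_mem_component {s : MvPolynomial (Fin m) (MvPolynomial (Fin n) k)}
    {r e : ℕ} {h : MvPolynomial (Fin n) k} (hh : h.IsHomogeneous e)
    (hs : ∀ f : ReesModule I g hg, (s • f).toPoly = Polynomial.monomial r h * f.toPoly)
    (δ : ℤ × ℤ) (f : ReesModule I g hg) (hf : f ∈ ReesModule.component I g hg d δ) :
    s • f ∈ ReesModule.component I g hg d (δ + ((e : ℤ) - r * d, (r : ℤ))) := by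
  rw [ReesModule.mem_component_iff] at hf ⊢
  intro t ht
  rw [hs] at ht ⊢
  by_cases hrt : r ≤ t
  · obtain ⟨t, rfl⟩ := Nat.exists_eq_add_of_le' hrt
    rw [Polynomial.coeff_monomial_mul] at ht ⊢
    obtain ⟨h1, ν, h2, h3⟩ := hf t (right_ne_zero_of_mul ht)
    refine ⟨by simp [h1], e + ν, ?_, hh.mul h3⟩
    push_cast
    rw [h2, Prod.fst_add]
    ring
  · refine absurd ?_ ht
    rw [← Polynomial.C_mul_X_pow_eq_monomial, mul_assoc, Polynomial.coeff_C_mul,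
      Polynomial.coeff_X_pow_mul', if_neg hrt, mul_zero]

theorem ReesModule.mem_component_of_smul {s : MvPolynomial (Fin m) (MvPolynomial (Fin n) k)}
    {r e : ℕ} {h : MvPolynomial (Fin n) k} (hh : h.IsHomogeneous e) (h0 : h ≠ 0)
    (hs : ∀ f : ReesModule I g hg, (s • f).toPoly = Polynomial.monomial r h * f.toPoly)
    (δ : ℤ × ℤ) (f : ReesModule I g hg)
    (hf : s • f ∈ ReesModule.component I g hg d (δ + ((e : ℤ) - r * d, (r : ℤ)))) :
    f ∈ ReesModule.component I g hg d δ := by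
  rw [ReesModule.mem_component_iff] at hf ⊢
  intro t ht
  have hc : (s • f).toPoly.coeff (t + r) = h * f.toPoly.coeff t := by
    rw [hs, Polynomial.coeff_monomial_mul]
  obtain ⟨h1, ν, h2, h3⟩ := hf (t + r) (by rw [hc]; exact mul_ne_zero h0 ht)
  rw [hc] at h3
  obtain ⟨i, rfl, hi⟩ := hh.exists_of_mul h0 h3 ht
  refine ⟨by simpa using h1, i, ?_, hi⟩
  push_cast at h2
  rw [Prod.fst_add] at h2
  linarith

theorem biDeg_x (a : Fin n) (d : ℕ) :
    biDeg n m (toLex (Sum.inl a)) = (((1 : ℕ) : ℤ) - ((0 : ℕ) : ℤ) * d, ((0 : ℕ) : ℤ)) := by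
  simp [biDeg]

theorem biDeg_t (j : Fin m) (d : ℕ) :
    biDeg n m (toLex (Sum.inr j)) = ((d : ℤ) - ((1 : ℕ) : ℤ) * d, ((1 : ℕ) : ℤ)) := by
  simp [biDeg]

theorem ReesModule.biVar_smul_mem_component (hgdeg : ∀ j, (g j).IsHomogeneous d)
    (i : Fin n ⊕ₗ Fin m) (δ : ℤ × ℤ) (f : ReesModule I g hg)
    (hf : f ∈ ReesModule.component I g hg d δ) :
    biVar k n m i • f ∈ ReesModule.component I g hg d (δ + biDeg n m i) := by
  obtain ⟨i, rfl⟩ := toLex.surjective i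
  rcases i with a | j
  · rw [biDeg_x a d]
    exact ReesModule.smul_mem_component (MvPolynomial.isHomogeneous_X k a)
      (ReesModule.toPoly_x_smul a) δ f hf
  · rw [biDeg_t j d]
    exact ReesModule.smul_mem_component (hgdeg j) (ReesModule.toPoly_t_smul j) δ f hf

/-- Otherwise `(I_{<d})` is a reduction of `I`. For `d > 0` it equals `(I_{≤ d-1})`, so `d` is not
minimal. For `d = 0` it is zero, so `I` is nilpotent, hence zero, although it contains a power of
`x_1`. -/
theorem exists_ne_zero_of_isReductionOf (hn : 0 < n) (hIrad : I.radical = irrelevantIdeal k n)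
    (hd : IsLeast {μ : ℕ | ∃ p : ℕ, idealLE I μ * I ^ p = I ^ (p + 1)} d)
    (hred : IsReductionOf (Ideal.span (Set.range g) ⊔ idealLT I d) I) : ∃ j, g j ≠ 0 := by
  by_contra! hall
  have hspan : Ideal.span (Set.range g) = ⊥ := by
    rw [Ideal.span_eq_bot]
    rintro _ ⟨j, rfl⟩
    exact hall j
  obtain ⟨-, p, hp⟩ := hred
  rw [hspan, bot_sup_eq] at hp
  cases d with
  | zero =>
    have hLT : idealLT I 0 = ⊥ := by simp [idealLT]
    rw [hLT, Ideal.bot_mul] at hp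
    have hI : I = ⊥ := by
      rw [← Ideal.zero_eq_bot] at hp ⊢
      exact eq_zero_of_pow_eq_zero hp.symm
    have hX : (MvPolynomial.X ⟨0, hn⟩ : MvPolynomial (Fin n) k) ∈ I.radical := by
      rw [hIrad]
      exact Ideal.subset_span ⟨_, rfl⟩
    obtain ⟨q, hq⟩ := hX
    rw [hI, Ideal.mem_bot] at hq
    exact MvPolynomial.X_ne_zero _ (eq_zero_of_pow_eq_zero hq)
  | succ μ =>
    have hLT : idealLT I (μ + 1) = idealLE I μ := by simp [idealLT, idealLE]
    rw [hLT] at hp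
    exact absurd (hd.2 ⟨p, hp⟩) (by simp)

theorem ReesModule.biVar_smul_eq_zero (hn : n = 0) (hI : I = ⊥) (i : Fin n ⊕ₗ Fin m)
    (f : ReesModule I g hg) : biVar k n m i • f = 0 := by
  obtain ⟨i, rfl⟩ := toLex.surjective i
  rcases i with a | j
  · subst hn
    exact a.elim0
  · have h0 : g j = 0 := by simpa [hI] using hg j
    refine ReesModule.toPoly_injective ?_
    rw [ReesModule.toPoly_t_smul, h0, map_zero, map_zero, zero_mul]

end Rees

end

/-! ### The two edge isomorphisms for the Rees algebra. -/

theorem mainTheorem7 {k : Type*} [Field k] {n m : ℕ}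
    -- a graded `𝔪`-primary ideal of `A = k[x_1, …, x_n]`
    (I : Ideal (MvPolynomial (Fin n) k))
    (hIgr : I.IsHomogeneous (MvPolynomial.homogeneousSubmodule (Fin n) k))
    (hIprim : I.IsPrimary) (hIrad : I.radical = irrelevantIdeal k n)
    -- `d = min {μ | ∃ p, (I_{≤ μ}) I^p = I^{p+1}}`
    (d : ℕ) (hd : IsLeast {μ : ℕ | ∃ p : ℕ, idealLE I μ * I ^ p = I ^ (p + 1)} d)
    -- `g_1, …, g_m ∈ I_d` such that `J + (I_{< d})` is a reduction of `I`, `J = (g_1, …, g_m)`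
    (g : Fin m → MvPolynomial (Fin n) k) (hg : ∀ j, g j ∈ I)
    (hgdeg : ∀ j, (g j).IsHomogeneous d)
    (hred : IsReductionOf (Ideal.span (Set.range g) ⊔ idealLT I d) I) :
    -- `φ : H^1_{𝔪+𝔫}(𝓡_I) ≃ H^0_𝔫(H^1_𝔪(𝓡_I))` and `ψ : H^1_{𝔪+𝔫}(𝓡_I) ≃ H^0_𝔪(H^1_𝔫(𝓡_I))`
    ∃ (φ : CechH (biVar k n m) Finset.univ 1 (ReesModule I g hg)
            ≃ₗ[MvPolynomial (Fin m) (MvPolynomial (Fin n) k)]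
          CechH (biVar k n m) (tVars n m) 0
            (CechH (biVar k n m) (xVars n m) 1 (ReesModule I g hg)))
      (ψ : CechH (biVar k n m) Finset.univ 1 (ReesModule I g hg)
            ≃ₗ[MvPolynomial (Fin m) (MvPolynomial (Fin n) k)]
          CechH (biVar k n m) (xVars n m) 0
            (CechH (biVar k n m) (tVars n m) 1 (ReesModule I g hg))),
      -- both are bigraded
      (∀ (δ : ℤ × ℤ) (z : CechH (biVar k n m) Finset.univ 1 (ReesModule I g hg)),
        φ z ∈ cechHComponent (biVar k n m) (biDeg n m) (tVars n m) 0
            (cechHComponent (biVar k n m) (biDeg n m) (xVars n m) 1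
              (ReesModule.component I g hg d)) δ ↔
          z ∈ cechHComponent (biVar k n m) (biDeg n m) Finset.univ 1
            (ReesModule.component I g hg d) δ) ∧
      (∀ (δ : ℤ × ℤ) (z : CechH (biVar k n m) Finset.univ 1 (ReesModule I g hg)),
        ψ z ∈ cechHComponent (biVar k n m) (biDeg n m) (xVars n m) 0
            (cechHComponent (biVar k n m) (biDeg n m) (tVars n m) 1
              (ReesModule.component I g hg d)) δ ↔
          z ∈ cechHComponent (biVar k n m) (biDeg n m) Finset.univ 1
            (ReesModule.component I g hg d) δ) ∧
      -- both are the canonical (edge) maps, induced by the projections of the total Čech complex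
      -- `C_{𝔪+𝔫} = Tot (C_𝔫 C_𝔪)` onto `C_𝔪` and onto `C_𝔫`
      (∀ z, cechHZeroToModule (biVar k n m) (tVars n m) _ (φ z) =
        cechRestrict (biVar k n m) (Finset.subset_univ (xVars n m)) 1 (ReesModule I g hg) z) ∧
      (∀ z, cechHZeroToModule (biVar k n m) (xVars n m) _ (ψ z) =
        cechRestrict (biVar k n m) (Finset.subset_univ (tVars n m)) 1 (ReesModule I g hg) z) := by
  have hw : ∀ i, i ∈ tVars n m ↔ i ∈ Finset.univ ∧ i ∉ xVars n m := fun i => by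
    simp [tVars, xVars]
  have hw' : ∀ i, i ∈ xVars n m ↔ i ∈ Finset.univ ∧ i ∉ tVars n m := fun i => by
    simp [tVars, xVars]
  rcases Nat.eq_zero_or_pos n with hn | hn
  -- Without `x`-variables `𝔪` is zero and offers no regular element. But then `I = 0`, every `T_j`
  -- acts as zero, all the localizations at single variables vanish, and with them every `H^1`.
  · have hI : I = ⊥ := by
      subst hn
      refine le_bot_iff.1 (Ideal.le_radical.trans (hIrad.trans ?_).le)
      simp [irrelevantIdeal]
    have hsub : ∀ u, Subsingleton (CechH (biVar k n m) u 1 (ReesModule I g hg)) := fun u =>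
      subsingleton_cechH_one _ fun i _ => ReesModule.biVar_smul_eq_zero hn hI i
    have hsub' : ∀ u w, Subsingleton
        (CechH (biVar k n m) w 0 (CechH (biVar k n m) u 1 (ReesModule I g hg))) := fun u w =>
      (cechHZeroToModule_injective _).subsingleton
    refine ⟨0, 0, fun δ z => ?_, fun δ z => ?_, fun z => Subsingleton.elim _ _,
      fun z => Subsingleton.elim _ _⟩
    · rw [Subsingleton.elim z 0, map_zero]
      exact iff_of_true (zero_mem _) (zero_mem _)
    · rw [Subsingleton.elim z 0, map_zero]
      exact iff_of_true (zero_mem _) (zero_mem _)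
  · obtain ⟨j, hj⟩ := exists_ne_zero_of_isReductionOf hn hIrad hd hred
    have hmul := ReesModule.biVar_smul_mem_component (hg := hg) hgdeg
    have hx : toLex (Sum.inl ⟨0, hn⟩) ∈ xVars n m := by simp [xVars]
    have ht : toLex (Sum.inr j) ∈ tVars n m := by simp [tVars]
    have hX : (MvPolynomial.X ⟨0, hn⟩ : MvPolynomial (Fin n) k) ≠ 0 := MvPolynomial.X_ne_zero _
    have hxreg := ReesModule.eq_zero_of_toPoly_smul (I := I) (hg := hg) hX
      (ReesModule.toPoly_x_smul ⟨0, hn⟩)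
    have htreg := ReesModule.eq_zero_of_toPoly_smul (I := I) (hg := hg) hj
      (ReesModule.toPoly_t_smul j)
    refine ⟨cechEdgeEquiv _ (Finset.subset_univ _) hw hx hxreg,
      cechEdgeEquiv _ (Finset.subset_univ _) hw' ht htreg,
      cechEdgeEquiv_mem_iff _ _ _ hw hx hxreg hmul ?_,
      cechEdgeEquiv_mem_iff _ _ _ hw' ht htreg hmul ?_,
      cechHZeroToModule_cechEdgeEquiv _ _ hw hx hxreg,
      cechHZeroToModule_cechEdgeEquiv _ _ hw' ht htreg⟩
    · rw [biDeg_x _ d]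
      exact ReesModule.mem_component_of_smul (MvPolynomial.isHomogeneous_X k _) hX
        (ReesModule.toPoly_x_smul _)
    · rw [biDeg_t _ d]
      exact ReesModule.mem_component_of_smul (hgdeg j) hj (ReesModule.toPoly_t_smul j)
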